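/- Let $K$ be a field and let $L$ be a finite planar distributive lattice, that is, a finite distributive lattice isomorphic to a sublattice of $\mathbb N\times\mathbb N$. Write $\alpha\nsim\beta$ if $\alpha$ and $\beta$ are not comparable; such an unordered pair is called a diamond of $L$. Let $K[L]=K[x_\alpha:\alpha\in L]$, let $f_{(\alpha,\beta)}=x_\alpha x_\beta-x_{\alpha\vee\beta}x_{\alpha\wedge\beta}$, let $I_L$ be the ideal generated by the $f_{(\alpha,\beta)}$ with $\alpha\nsim\beta$, and let $R[L]=K[L]/I_L$ be the Hibi ring. The first syzygy of $R[L]$ is the kernel of the map $\varphi:\bigoplus_{\text{diamonds}}K[L](-2)\to K[L]$, $g_{(\alpha,\beta)}\mapsto f_{(\alpha,\beta)}$, where $g_{(\alpha,\beta)}=g_{(\beta,\alpha)}$ is the basis element of the diamond $(\alpha,\beta)$. Consider the following elements of $\ker\varphi$, where $\alpha\nsim\beta_1$ and $\alpha\nsim\beta_2$. * Strip type: if $\alpha\vee\beta_1\ne\alpha\vee\beta_2$, $\alpha\wedge\beta_1=\alpha\wedge\beta_2$, $\beta_1\le\beta_2$, $\beta_2\nsim\alpha\vee\beta_1$, then $-x_{\beta_2}g_{(\alpha,\beta_1)}+x_{\beta_1}g_{(\alpha,\beta_2)}-x_{\alpha\wedge\beta_1}g_{(\beta_2,\alpha\vee\beta_1)}$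 and $x_{\alpha\vee\beta_2}g_{(\alpha,\beta_1)}-x_{\alpha\vee\beta_1}g_{(\alpha,\beta_2)}+x_\alpha g_{(\beta_2,\alpha\vee\beta_1)}$. * $L$-type: if $\alpha\vee\beta_1\ne\alpha\vee\beta_2$, $\alpha\wedge\beta_1\ne\alpha\wedge\beta_2$, $\beta_1\le\beta_2$, $\beta_1\nsim\alpha\wedge\beta_2$, $\beta_2\nsim\alpha\vee\beta_1$, then $-x_{\beta_2}g_{(\alpha,\beta_1)}+x_{\beta_1}g_{(\alpha,\beta_2)}+x_{\alpha\vee\beta_2}g_{(\beta_1,\alpha\wedge\beta_2)}-x_{\alpha\wedge\beta_1}g_{(\beta_2,\alpha\vee\beta_1)}$. * Box type: if $\alpha\vee\beta_1\ne\alpha\vee\beta_2$, $\alpha\wedge\beta_1\ne\alpha\wedge\beta_2$, $\beta_1\nsim\beta_2$, $\alpha\wedge\beta_2\le\beta_1\le\alpha\vee\beta_2$, $\beta_2\nsim\alpha\vee\beta_1$, $\beta_2\nsim\alpha\wedge\beta_1$, then $-x_{\beta_2}g_{(\alpha,\beta_1)}+x_{\beta_1}g_{(\alpha,\beta_2)}-x_{\alpha\vee\beta_1}g_{(\beta_2,\alpha\wedge\beta_1)}-x_{\alpha\wedge\beta_2}g_{(\alpha\vee\beta_1,\beta_1\vee\beta_2)}$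 and $-x_{\beta_1}g_{(\alpha,\beta_2)}+x_{\alpha}g_{(\beta_1,\beta_2)}+x_{\beta_1\vee\beta_2}g_{(\alpha,\beta_1\wedge\beta_2)}+x_{\alpha\wedge\beta_2}g_{(\alpha\vee\beta_1,\beta_1\vee\beta_2)}$. The diamond-type syzygy of two diamonds $(\alpha_1,\beta_1)$, $(\alpha_2,\beta_2)$ is $f_{(\alpha_2,\beta_2)}g_{(\alpha_1,\beta_1)}-f_{(\alpha_1,\beta_1)}g_{(\alpha_2,\beta_2)}$. Theorem. Suppose that for any two diamonds $(\alpha_1,\beta_1)$ and $(\alpha_2,\beta_2)$ of $L$ with $\alpha_1,\beta_1\le\alpha_2$ and $\alpha_1,\beta_1\le\beta_2$ (a comparable pair of diamonds) at least one of the following holds: 1. there is a diamond $(\alpha_3,\beta_3)$ of $L$ with $\alpha_1\vee\beta_1\le\alpha_3\le\alpha_2\wedge\beta_2$, $\alpha_3\wedge\beta_3\in\{\alpha_1,\beta_1\}$ and $\alpha_3\vee\beta_3\in\{\alpha_2,\beta_2\}$; 2. the diamond-type syzygy of the two diamonds is a $K[L]$-linear combination of syzygies of strip, $L$ and box type. Then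 the first syzygy of $R[L]$ is linear: $\ker\varphi$ is generated as a $K[L]$-module by its elements all of whose coefficients are linear forms. In particular this holds if every diamond-type syzygy is a $K[L]$-linear combination of syzygies of strip, $L$ and box type. -/

import Mathlib

open MvPolynomial

noncomputable section

/-- A (finite distributive) lattice is planar if it is, up to isomorphism, a sublattice of the
product `ℕ × ℕ` of two chains. -/
def IsPlanarLattice (L : Type*) [Lattice L] : Prop :=
  ∃ f : LatticeHom L (ℕ × ℕ), Function.Injective f

/-- `α ≁ β`: the elements `α` and `β` are not comparable. Such a pair spans the diamond
`{α, β, α ⊔ β, α ⊓ β}`. -/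
abbrev Incomp {L : Type*} [Lattice L] (α β : L) : Prop :=
  IncompRel (· ≤ ·) α β

theorem Incomp.symmetric (L : Type*) [Lattice L] : Std.Symm (Incomp (L := L)) :=
  ⟨fun _ _ h => h.symm⟩

/-- The diamonds of `L`: the unordered pairs of incomparable elements. They index the diamond
relations, so that each relation is listed once. -/
abbrev Diamond (L : Type*) [Lattice L] : Type _ :=
  {z : Sym2 L // z ∈ Sym2.fromRel (Incomp.symmetric L)}

section Hibi

variable (K : Type*) [Field K] {L : Type*} [Lattice L]

/-- The diamond relation `f_{(α,β)} = x_α x_β - x_{α ⊔ β} x_{α ⊓ β}` in `K[L]`. -/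
def diamondRel (α β : L) : MvPolynomial L K :=
  X α * X β - X (α ⊔ β) * X (α ⊓ β)

theorem diamondRel_comm (α β : L) : diamondRel K α β = diamondRel K β α := by
  simp only [diamondRel, sup_comm, inf_comm, mul_comm (X α)]

/-- The diamond relation of an (unordered) diamond. -/
def diamondRelOf (d : Diamond L) : MvPolynomial L K :=
  Sym2.lift ⟨diamondRel K, diamondRel_comm K⟩ d.1

variable (L) in
/-- The ideal `I_L` of `K[L]` generated by the diamond relations. -/
def hibiIdeal : Ideal (MvPolynomial L K) :=
  Ideal.span {f | ∃ α β : L, Incomp α β ∧ f = diamondRel K α β}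

variable (L) in
/-- The Hibi ring `R[L] = K[L] / I_L`. -/
abbrev HibiRing : Type _ := MvPolynomial L K ⧸ hibiIdeal K L

variable (L) in
/-- The free `K[L]`-module `⨁ K[L](-2)` with one basis element `g_d` for each diamond `d`. -/
abbrev DiamondModule : Type _ := Diamond L →₀ MvPolynomial L K

variable (L) in
/-- The map `φ : ⨁ K[L](-2) → K[L]`, `g_d ↦ f_d`. -/
def diamondMap : DiamondModule K L →ₗ[MvPolynomial L K] MvPolynomial L K :=
  Finsupp.linearCombination (MvPolynomial L K) (diamondRelOf K)

variable (L) in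
/-- The first syzygy of the Hibi ring `R[L]`: the kernel of `φ`. -/
def firstSyzygy : Submodule (MvPolynomial L K) (DiamondModule K L) :=
  LinearMap.ker (diamondMap K L)

/-- The image of `φ` is the defining ideal of the Hibi ring. -/
theorem range_diamondMap : LinearMap.range (diamondMap K L) = hibiIdeal K L := by
  rw [diamondMap, Finsupp.range_linearCombination, hibiIdeal, Ideal.span]
  congr 1
  ext f
  constructor
  · rintro ⟨⟨z, hz⟩, rfl⟩
    induction z using Sym2.ind with
    | _ a b => exact ⟨a, b, hz, rfl⟩
  · rintro ⟨a, b, h, rfl⟩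
    exact ⟨⟨s(a, b), h⟩, rfl⟩

variable (L) in
/-- The first syzygy of the Hibi ring is linear: it is generated by syzygies all of whose
coefficients are linear forms, that is, by its elements of degree one relative to the quadratic
generators of the Hibi ideal. -/
def FirstSyzygyIsLinear : Prop :=
  Submodule.span (MvPolynomial L K)
    {s : DiamondModule K L | s ∈ firstSyzygy K L ∧ ∀ d, (s d).IsHomogeneous 1} =
  firstSyzygy K L

open Classical in
/-- The basis element `g_{(α,β)} = g_{(β,α)}` of the diamond `(α, β)`; by convention it is `0` for
a comparable pair, whose relation `f_{(α,β)}` is `0`. -/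
def gen (α β : L) : DiamondModule K L :=
  if h : Incomp α β then Finsupp.single ⟨s(α, β), h⟩ 1 else 0

theorem diamondMap_gen (α β : L) : diamondMap K L (gen K α β) = diamondRel K α β := by
  unfold gen
  split_ifs with h
  · simp [diamondMap, diamondRelOf]
  · rw [map_zero]
    by_cases hab : α ≤ β
    · simp [diamondRel, hab, mul_comm]
    · have hba : β ≤ α := by
        by_contra hba
        exact h ⟨hab, hba⟩
      simp [diamondRel, hba]

/-- The position of `(α, β₁), (α, β₂)` that gives the strip-type syzygies: the six elements
`α, β₁, β₂, α ⊓ β₁, α ⊔ β₁, α ⊔ β₂` form a product of a two- and a three-element chain. -/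
def IsStrip (α β₁ β₂ : L) : Prop :=
  Incomp α β₁ ∧ Incomp α β₂ ∧
  α ⊔ β₁ ≠ α ⊔ β₂ ∧ α ⊓ β₁ = α ⊓ β₂ ∧ β₁ ≤ β₂ ∧ β₁ ≤ α ⊔ β₂ ∧ α ⊓ β₂ ≤ β₁ ∧
  Incomp β₂ (α ⊔ β₁) ∧ α ⊓ β₁ ≤ β₂

/-- The strip-type syzygies, of the two kinds `S₁` and `S₂`. -/
def stripTypes : Set (DiamondModule K L) :=
  {s | ∃ α β₁ β₂ : L, IsStrip α β₁ β₂ ∧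
    (s = -((X β₂ : MvPolynomial L K) • gen K α β₁) + (X β₁ : MvPolynomial L K) • gen K α β₂
          - (X (α ⊓ β₁) : MvPolynomial L K) • gen K β₂ (α ⊔ β₁) ∨
     s = (X (α ⊔ β₂) : MvPolynomial L K) • gen K α β₁
          - (X (α ⊔ β₁) : MvPolynomial L K) • gen K α β₂
          + (X α : MvPolynomial L K) • gen K β₂ (α ⊔ β₁))}

/-- The position of `(α, β₁), (α, β₂)` that gives the `L`-type syzygy. -/
def IsLShape (α β₁ β₂ : L) : Prop :=
  Incomp α β₁ ∧ Incomp α β₂ ∧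
  α ⊓ β₁ ≠ α ⊓ β₂ ∧ α ⊔ β₁ ≠ α ⊔ β₂ ∧ β₁ ≤ β₂ ∧ β₁ ≤ α ⊔ β₂ ∧ Incomp β₁ (α ⊓ β₂) ∧
  Incomp β₂ (α ⊔ β₁) ∧ α ⊓ β₁ ≤ β₂

/-- The `L`-type syzygies. -/
def lTypes : Set (DiamondModule K L) :=
  {s | ∃ α β₁ β₂ : L, IsLShape α β₁ β₂ ∧
    s = -((X β₂ : MvPolynomial L K) • gen K α β₁) + (X β₁ : MvPolynomial L K) • gen K α β₂
          + (X (α ⊔ β₂) : MvPolynomial L K) • gen K β₁ (α ⊓ β₂)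
          - (X (α ⊓ β₁) : MvPolynomial L K) • gen K β₂ (α ⊔ β₁)}

/-- The position of `(α, β₁), (α, β₂)` that gives the box-type syzygies. -/
def IsBox (α β₁ β₂ : L) : Prop :=
  Incomp α β₁ ∧ Incomp α β₂ ∧
  α ⊓ β₁ ≠ α ⊓ β₂ ∧ α ⊔ β₁ ≠ α ⊔ β₂ ∧ Incomp β₁ β₂ ∧ β₁ ≤ α ⊔ β₂ ∧ α ⊓ β₂ ≤ β₁ ∧
  Incomp β₂ (α ⊔ β₁) ∧ Incomp β₂ (α ⊓ β₁)

/-- The box-type syzygies, of the two kinds `B₁` and `B₂`. -/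
def boxTypes : Set (DiamondModule K L) :=
  {s | ∃ α β₁ β₂ : L, IsBox α β₁ β₂ ∧
    (s = -((X β₂ : MvPolynomial L K) • gen K α β₁) + (X β₁ : MvPolynomial L K) • gen K α β₂
          - (X (α ⊔ β₁) : MvPolynomial L K) • gen K β₂ (α ⊓ β₁)
          - (X (α ⊓ β₂) : MvPolynomial L K) • gen K (α ⊔ β₁) (β₁ ⊔ β₂) ∨
     s = -((X β₁ : MvPolynomial L K) • gen K α β₂) + (X α : MvPolynomial L K) • gen K β₁ β₂
          + (X (β₁ ⊔ β₂) : MvPolynomial L K) • gen K α (β₁ ⊓ β₂)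
          + (X (α ⊓ β₂) : MvPolynomial L K) • gen K (α ⊔ β₁) (β₁ ⊔ β₂))}

/-- The diamond-type syzygy `f_{(α₂,β₂)} g_{(α₁,β₁)} - f_{(α₁,β₁)} g_{(α₂,β₂)}` arising from the
two diamonds `(α₁, β₁)` and `(α₂, β₂)`. -/
def diamondSyzygy (α₁ β₁ α₂ β₂ : L) : DiamondModule K L :=
  diamondRel K α₂ β₂ • gen K α₁ β₁ - diamondRel K α₁ β₁ • gen K α₂ β₂

/-- The diamond-type syzygy of `(α₁, β₁)` and `(α₂, β₂)` is a `K[L]`-linear combination of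
syzygies of strip, `L` and box type. -/
def DiamondExpressible (α₁ β₁ α₂ β₂ : L) : Prop :=
  diamondSyzygy K α₁ β₁ α₂ β₂ ∈
    Submodule.span (MvPolynomial L K) (stripTypes K ∪ lTypes K ∪ boxTypes K)

end Hibi

section Position

variable {L : Type*} [Lattice L]

/-- The diamonds `(α₁, β₁)` and `(α₂, β₂)` are comparable, the first one being the lower one. -/
def DiamondsComparable (α₁ β₁ α₂ β₂ : L) : Prop :=
  α₁ ≤ α₂ ∧ α₁ ≤ β₂ ∧ β₁ ≤ α₂ ∧ β₁ ≤ β₂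

/-- A third diamond `(α₃, β₃)` joins the lower diamond `(α₁, β₁)` to the upper diamond
`(α₂, β₂)`: the element `α₃` lies in the interval from the top `α₁ ⊔ β₁` of the lower diamond to the
bottom `α₂ ⊓ β₂` of the upper one, `α₃ ⊓ β₃` is one of the two side vertices `α₁, β₁` of the lower
diamond, and `α₃ ⊔ β₃` is one of the two side vertices `α₂, β₂` of the upper one. -/
def HasJoiningDiamond (α₁ β₁ α₂ β₂ : L) : Prop :=
  ∃ α₃ β₃ : L, Incomp α₃ β₃ ∧ α₁ ⊔ β₁ ≤ α₃ ∧ α₃ ≤ α₂ ⊓ β₂ ∧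
    (α₃ ⊓ β₃ = α₁ ∨ α₃ ⊓ β₃ = β₁) ∧ (α₃ ⊔ β₃ = α₂ ∨ α₃ ⊔ β₃ = β₂)

end Position

end

/-! Treat each diamond relation as an exchange `x_a x_b → x_{a ⊔ b} x_{a ⊓ b}` of monomials. A
strictly concave function of the rank decreases under exchanges, so they terminate. A path of
exchanges from a monomial to its normal form records an element of the free module; `pathClass` is
its class modulo a submodule `N` along an arbitrarily chosen path. If the class does not depend on
the path, the `K`-linear map `ψ` sending a monomial to its path class satisfies `ψ ∘ φ = N.mkQ`,
whence `ker φ ≤ N`.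

Independence is confluence modulo `N`, by induction on the weight. Two exchanges sharing a variable
both continue to join, median and meet of three elements, and the two routes differ by a linear
syzygy (`sortPath_sub_mem`). Disjoint exchanges are linked through an incomparable cross pair if
there is one; otherwise the diamonds are comparable and the obstruction is exactly their
diamond-type syzygy. With `N` the span of the linear syzygies, a joining diamond places this
obstruction in `N` (`diamondSyzygy_mem_of_join`), and so does expressibility, the strip, `L` and box
types being linear. -/

noncomputable section

section Linear

variable (K : Type*) [Field K] {L : Type*}

/-! ### Linear coefficients and formal rules for generators -/

section Lattice

variable [Lattice L]

/-- The elements of the free module all of whose coefficients are linear forms. -/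
def HasLinearCoeffs (s : DiamondModule K L) : Prop :=
  ∀ d, (s d).IsHomogeneous 1

variable {K}

theorem HasLinearCoeffs.add {s t : DiamondModule K L} (hs : HasLinearCoeffs K s)
    (ht : HasLinearCoeffs K t) : HasLinearCoeffs K (s + t) :=
  fun d => (hs d).add (ht d)

theorem HasLinearCoeffs.neg {s : DiamondModule K L} (hs : HasLinearCoeffs K s) :
    HasLinearCoeffs K (-s) :=
  fun d => (hs d).neg

theorem HasLinearCoeffs.sub {s t : DiamondModule K L} (hs : HasLinearCoeffs K s)
    (ht : HasLinearCoeffs K t) : HasLinearCoeffs K (s - t) :=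
  fun d => (hs d).sub (ht d)

variable (K)

/-- No incomparability is needed, since zero is homogeneous of every degree; degenerate diamonds
thus cost no case distinctions later. -/
theorem hasLinearCoeffs_X_smul_gen (a b c : L) :
    HasLinearCoeffs K ((X a : MvPolynomial L K) • gen K b c) := by
  classical
  intro d
  unfold gen
  split_ifs
  · rw [Finsupp.smul_single, smul_eq_mul, mul_one, Finsupp.single_apply]
    split_ifs
    · exact isHomogeneous_X K a
    · exact isHomogeneous_zero L K 1
  · simpa using isHomogeneous_zero L K 1

variable (L) in
/-- The submodule generated by the linear syzygies. -/
def linearSpan : Submodule (MvPolynomial L K) (DiamondModule K L) :=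
  Submodule.span (MvPolynomial L K)
    {s : DiamondModule K L | s ∈ firstSyzygy K L ∧ ∀ d, (s d).IsHomogeneous 1}

variable {K}

theorem HasLinearCoeffs.mem_linearSpan {s : DiamondModule K L} (hs : HasLinearCoeffs K s)
    (h : diamondMap K L s = 0) : s ∈ linearSpan K L :=
  Submodule.subset_span ⟨h, hs⟩

variable (K)

theorem gen_comm (a b : L) : gen K a b = gen K b a := by
  unfold gen
  by_cases h : Incomp a b
  · rw [dif_pos h, dif_pos h.symm]
    congr 2
    exact Sym2.eq_swap
  · rw [dif_neg h, dif_neg fun h' => h h'.symm]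

theorem gen_of_not_incomp {a b : L} (h : ¬ Incomp a b) : gen K a b = 0 :=
  dif_neg h

theorem le_or_ge_of_not_incomp {a b : L} (h : ¬ Incomp a b) : a ≤ b ∨ b ≤ a := by
  by_contra! h'
  exact h h'

theorem diamondSyzygy_comm_left (a b c d : L) :
    diamondSyzygy K b a c d = diamondSyzygy K a b c d := by
  simp only [diamondSyzygy, gen_comm K b a, diamondRel_comm K b a]

theorem diamondSyzygy_comm_right (a b c d : L) :
    diamondSyzygy K a b d c = diamondSyzygy K a b c d := by
  simp only [diamondSyzygy, gen_comm K d c, diamondRel_comm K d c]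

theorem diamondSyzygy_swap (a b c d : L) :
    diamondSyzygy K c d a b = -diamondSyzygy K a b c d := by
  simp only [diamondSyzygy, neg_sub]

/-- Sorting a degree-three monomial `x_a x_b x_c` by three exchanges. -/
def sortPath (a b c : L) : DiamondModule K L :=
  (X c : MvPolynomial L K) • gen K a b + (X (a ⊓ b) : MvPolynomial L K) • gen K (a ⊔ b) c
    + (X (a ⊔ b ⊔ c) : MvPolynomial L K) • gen K (a ⊓ b) ((a ⊔ b) ⊓ c)

theorem diamondMap_sortPath (a b c : L) :
    diamondMap K L (sortPath K a b c) = X a * X b * X c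
      - X (a ⊔ b ⊔ c) * X ((a ⊓ b) ⊔ ((a ⊔ b) ⊓ c)) * X ((a ⊓ b) ⊓ ((a ⊔ b) ⊓ c)) := by
  simp only [sortPath, map_add, map_smul, diamondMap_gen, diamondRel, smul_eq_mul]
  ring

end Lattice

/-! ### Explicit linear syzygies in a distributive lattice -/

section Distrib

variable [DistribLattice L]

/-- By distributivity both sides are the median `(a ⊓ b) ⊔ (a ⊓ c) ⊔ (b ⊓ c)`. -/
theorem median_swap (a b c : L) :
    (a ⊓ b) ⊔ ((a ⊔ b) ⊓ c) = (a ⊓ c) ⊔ ((a ⊔ c) ⊓ b) := by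
  rw [inf_sup_right, inf_sup_right, inf_comm c b]
  exact sup_left_comm ..

theorem inf_inf_sup_inf (a b c : L) : (a ⊓ b) ⊓ ((a ⊔ b) ⊓ c) = a ⊓ b ⊓ c := by
  rw [← inf_assoc, inf_eq_left.2 (inf_le_left.trans le_sup_left : a ⊓ b ≤ a ⊔ b)]

/-- Both routes lead from `x_a x_b x_c` to the same product of join, median and meet, so `φ` kills
their difference. -/
theorem sortPath_sub_mem (a b c : L) :
    sortPath K a b c - sortPath K a c b ∈ linearSpan K L := by
  refine HasLinearCoeffs.mem_linearSpan (.sub (.add (.add ?_ ?_) ?_) (.add (.add ?_ ?_) ?_)) ?_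
  any_goals apply hasLinearCoeffs_X_smul_gen
  rw [map_sub, diamondMap_sortPath, diamondMap_sortPath, median_swap a c b, inf_inf_sup_inf,
    inf_inf_sup_inf, inf_right_comm a c b, sup_right_comm a c b, mul_right_comm (X a) (X c)]
  exact sub_self _

theorem mem_linearSpan_of_eq {a b c d p q r s t u v w : L}
    (h : (X a * diamondRel K b c + X d * diamondRel K p q - X r * diamondRel K s t
      - X u * diamondRel K v w : MvPolynomial L K) = 0) :
    (X a : MvPolynomial L K) • gen K b c + (X d : MvPolynomial L K) • gen K p q
      - (X r : MvPolynomial L K) • gen K s t - (X u : MvPolynomial L K) • gen K v w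
      ∈ linearSpan K L := by
  refine HasLinearCoeffs.mem_linearSpan (.sub (.sub (.add ?_ ?_) ?_) ?_) ?_
  any_goals apply hasLinearCoeffs_X_smul_gen
  simpa only [map_sub, map_add, map_smul, diamondMap_gen, smul_eq_mul] using h

/-- A diamond joining the left vertex of the lower diamond to the left vertex of the upper one
makes their diamond-type syzygy a combination of five linear syzygies. -/
theorem diamondSyzygy_mem_of_join {α₁ β₁ α₂ β₂ α₃ β₃ : L}
    (h₁ : α₁ ⊔ β₁ ≤ α₃) (h₂ : α₃ ≤ α₂ ⊓ β₂) (hi : α₃ ⊓ β₃ = α₁) (hs : α₃ ⊔ β₃ = α₂) :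
    diamondSyzygy K α₁ β₁ α₂ β₂ ∈ linearSpan K L := by
  have hβ₁ : β₁ ≤ α₃ := le_sup_right.trans h₁
  have hβ₂ : α₃ ≤ β₂ := h₂.trans inf_le_right
  have hα₁ : α₁ ≤ β₃ := hi ▸ inf_le_right
  have hα₁' : α₁ ≤ α₃ := hi ▸ inf_le_left
  have hα₂ : β₃ ≤ α₂ := hs ▸ le_sup_right
  have hα₂' : α₃ ≤ α₂ := hs ▸ le_sup_left
  -- `t` and `b` are tops and bottoms of the two diamonds. Just as `β₃` complements `α₃` in `[α₁,
  -- α₂]`, the elements `u`, `v`, `w` complement it in `[α₁, b₂]`, `[t₁, α₂]` and `[t₁, b₂]`.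
  obtain ⟨t₁, ht₁⟩ : ∃ t, t = α₁ ⊔ β₁ := ⟨_, rfl⟩
  obtain ⟨b₁, hb₁⟩ : ∃ t, t = α₁ ⊓ β₁ := ⟨_, rfl⟩
  obtain ⟨t₂, ht₂⟩ : ∃ t, t = α₂ ⊔ β₂ := ⟨_, rfl⟩
  obtain ⟨b₂, hb₂⟩ : ∃ t, t = α₂ ⊓ β₂ := ⟨_, rfl⟩
  obtain ⟨u, hu⟩ : ∃ t, t = β₃ ⊓ b₂ := ⟨_, rfl⟩
  obtain ⟨v, hv⟩ : ∃ t, t = β₃ ⊔ t₁ := ⟨_, rfl⟩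
  obtain ⟨w, hw⟩ : ∃ t, t = v ⊓ b₂ := ⟨_, rfl⟩
  rw [← ht₁] at h₁
  rw [← hb₂] at h₂
  have ht₁b₂ : t₁ ≤ b₂ := h₁.trans h₂
  have hα₁b₂ : α₁ ≤ b₂ := hα₁'.trans h₂
  have hβ₁b₂ : β₁ ≤ b₂ := hβ₁.trans h₂
  have hb₂α₂ : b₂ ≤ α₂ := hb₂ ▸ inf_le_left
  have hvα₂ : v ≤ α₂ := hv ▸ sup_le hα₂ (h₁.trans hα₂')
  have i₁ : α₃ ⊓ u = α₁ := by
    rw [hu, ← inf_assoc, hi]; exact inf_eq_left.2 hα₁b₂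
  have s₁ : α₃ ⊔ u = b₂ := by
    rw [hu, sup_inf_left, hs, sup_eq_right.2 h₂]; exact inf_eq_right.2 hb₂α₂
  have i₂ : α₃ ⊓ v = t₁ := by
    rw [hv, inf_sup_left, hi, inf_eq_right.2 h₁]; exact sup_eq_right.2 (ht₁ ▸ le_sup_left)
  have s₂ : α₃ ⊔ v = α₂ := by
    rw [hv, ← sup_assoc, hs]; exact sup_eq_left.2 (h₁.trans hα₂')
  have i₃ : α₃ ⊓ w = t₁ := by
    rw [hw, ← inf_assoc, i₂]; exact inf_eq_left.2 ht₁b₂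
  have s₃ : α₃ ⊔ w = b₂ := by
    rw [hw, sup_inf_left, s₂, sup_eq_right.2 h₂]; exact inf_eq_right.2 hb₂α₂
  have i₄ : β₁ ⊓ β₃ = b₁ := by
    calc β₁ ⊓ β₃ = β₁ ⊓ (α₃ ⊓ β₃) := by rw [← inf_assoc, inf_eq_left.2 hβ₁]
      _ = b₁ := by rw [hi, hb₁, inf_comm]
  have s₄ : β₁ ⊔ β₃ = v := by
    rw [hv, ht₁, ← sup_assoc, sup_eq_left.2 hα₁, sup_comm]
  have i₅ : β₁ ⊓ u = b₁ := by
    rw [hu, ← inf_assoc, i₄]; exact inf_eq_left.2 (hb₁ ▸ inf_le_right.trans hβ₁b₂)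
  have s₅ : β₁ ⊔ u = w := by
    rw [hu, sup_inf_left, s₄, sup_eq_right.2 hβ₁b₂, hw]
  have i₆ : β₂ ⊓ β₃ = u := by
    rw [hu, hb₂, ← inf_assoc, inf_eq_left.2 hα₂, inf_comm]
  have s₆ : β₂ ⊔ β₃ = t₂ := by
    calc β₂ ⊔ β₃ = β₂ ⊔ (α₃ ⊔ β₃) := by rw [← sup_assoc, sup_eq_left.2 hβ₂]
      _ = t₂ := by rw [hs, ht₂, sup_comm]
  have i₇ : β₂ ⊓ v = w := by
    rw [hw, hb₂, ← inf_assoc, inf_eq_left.2 hvα₂, inf_comm]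
  have s₇ : β₂ ⊔ v = t₂ := by
    calc β₂ ⊔ v = β₂ ⊔ (α₃ ⊔ v) := by rw [← sup_assoc, sup_eq_left.2 hβ₂]
      _ = t₂ := by rw [s₂, ht₂, sup_comm]
  -- Each of the five relations compares two two-step routes with common ends, starting from the
  -- product of the variables indexed by `a`, `b`, `c`.
  have e₁ := mem_linearSpan_of_eq K (a := β₁) (b := α₃) (c := β₃) (d := α₂) (p := α₁) (q := β₁)
    (r := α₃) (s := β₁) (t := β₃) (u := b₁) (v := α₃) (w := v) (by
      simp only [diamondRel, hi, hs, ← ht₁, ← hb₁, i₄, s₄, i₂, s₂]; ring)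
  have e₂ := mem_linearSpan_of_eq K (a := β₁) (b := α₃) (c := u) (d := b₂) (p := α₁) (q := β₁)
    (r := α₃) (s := β₁) (t := u) (u := b₁) (v := α₃) (w := w) (by
      simp only [diamondRel, i₁, s₁, ← ht₁, ← hb₁, i₅, s₅, i₃, s₃]; ring)
  have e₃ := mem_linearSpan_of_eq K (a := β₂) (b := α₃) (c := β₃) (d := α₁) (p := α₂) (q := β₂)
    (r := α₃) (s := β₂) (t := β₃) (u := t₂) (v := α₃) (w := u) (by
      simp only [diamondRel, hi, hs, ← ht₂, ← hb₂, i₆, s₆, i₁, s₁]; ring)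
  have e₄ := mem_linearSpan_of_eq K (a := β₂) (b := α₃) (c := v) (d := t₁) (p := α₂) (q := β₂)
    (r := α₃) (s := β₂) (t := v) (u := t₂) (v := α₃) (w := w) (by
      simp only [diamondRel, i₂, s₂, ← ht₂, ← hb₂, i₇, s₇, i₃, s₃]; ring)
  have e₅ := mem_linearSpan_of_eq K (a := β₂) (b := β₁) (c := β₃) (d := b₁) (p := β₂) (q := v)
    (r := β₁) (s := β₂) (t := β₃) (u := t₂) (v := β₁) (w := u) (by
      simp only [diamondRel, i₄, s₄, i₇, s₇, i₆, s₆, i₅, s₅]; ring)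
  -- All auxiliary generators cancel; `g_{(α₁,β₁)}` keeps `x_{α₂} x_{β₂} - x_{t₂} x_{b₂}`, and
  -- `g_{(α₂,β₂)}` keeps `x_{b₁} x_{t₁} - x_{α₁} x_{β₁}`.
  have key : diamondSyzygy K α₁ β₁ α₂ β₂ =
      (X β₂ : MvPolynomial L K) •
      ((X β₁ : MvPolynomial L K) • gen K α₃ β₃ + (X α₂ : MvPolynomial L K) • gen K α₁ β₁
        - (X α₃ : MvPolynomial L K) • gen K β₁ β₃ - (X b₁ : MvPolynomial L K) • gen K α₃ v)
      - (X t₂ : MvPolynomial L K) •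
      ((X β₁ : MvPolynomial L K) • gen K α₃ u + (X b₂ : MvPolynomial L K) • gen K α₁ β₁
        - (X α₃ : MvPolynomial L K) • gen K β₁ u - (X b₁ : MvPolynomial L K) • gen K α₃ w)
      - (X β₁ : MvPolynomial L K) •
      ((X β₂ : MvPolynomial L K) • gen K α₃ β₃ + (X α₁ : MvPolynomial L K) • gen K α₂ β₂
        - (X α₃ : MvPolynomial L K) • gen K β₂ β₃ - (X t₂ : MvPolynomial L K) • gen K α₃ u)
      + (X b₁ : MvPolynomial L K) •
      ((X β₂ : MvPolynomial L K) • gen K α₃ v + (X t₁ : MvPolynomial L K) • gen K α₂ β₂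
        - (X α₃ : MvPolynomial L K) • gen K β₂ v - (X t₂ : MvPolynomial L K) • gen K α₃ w)
      + (X α₃ : MvPolynomial L K) •
      ((X β₂ : MvPolynomial L K) • gen K β₁ β₃ + (X b₁ : MvPolynomial L K) • gen K β₂ v
        - (X β₁ : MvPolynomial L K) • gen K β₂ β₃ - (X t₂ : MvPolynomial L K) • gen K β₁ u) := by
    simp only [diamondSyzygy, diamondRel, ← ht₁, ← ht₂, ← hb₁, ← hb₂]
    module
  rw [key]
  exact add_mem (add_mem (sub_mem (sub_mem (Submodule.smul_mem _ _ e₁) (Submodule.smul_mem _ _ e₂))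
    (Submodule.smul_mem _ _ e₃)) (Submodule.smul_mem _ _ e₄)) (Submodule.smul_mem _ _ e₅)

theorem diamondSyzygy_mem_of_hasJoiningDiamond {α₁ β₁ α₂ β₂ : L}
    (h : HasJoiningDiamond α₁ β₁ α₂ β₂) : diamondSyzygy K α₁ β₁ α₂ β₂ ∈ linearSpan K L := by
  obtain ⟨α₃, β₃, -, h₁, h₂, hi | hi, hs | hs⟩ := h
  · exact diamondSyzygy_mem_of_join K h₁ h₂ hi hs
  · rw [← diamondSyzygy_comm_right]
    exact diamondSyzygy_mem_of_join K h₁ (inf_comm α₂ β₂ ▸ h₂) hi hs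
  · rw [← diamondSyzygy_comm_left]
    exact diamondSyzygy_mem_of_join K (sup_comm α₁ β₁ ▸ h₁) h₂ hi hs
  · rw [← diamondSyzygy_comm_left, ← diamondSyzygy_comm_right]
    exact diamondSyzygy_mem_of_join K (sup_comm α₁ β₁ ▸ h₁) (inf_comm α₂ β₂ ▸ h₂) hi hs

/-- Distributivity gives the auxiliary diamond `(β₂, α ⊔ β₁)` join `α ⊔ β₂` and meet `β₁`, after
which the cubic terms cancel. -/
theorem stripTypes_subset_linearSpan : stripTypes K ⊆ (linearSpan K L : Set (DiamondModule K L)) := by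
  rintro s ⟨α, β₁, β₂, ⟨-, -, -, hi, hle, -, -, -, -⟩, rfl | rfl⟩
  · refine HasLinearCoeffs.mem_linearSpan (.sub (.add (.neg ?_) ?_) ?_) ?_
    any_goals apply hasLinearCoeffs_X_smul_gen
    have h₁ : β₂ ⊔ (α ⊔ β₁) = α ⊔ β₂ := by
      rw [sup_left_comm, sup_eq_left.2 hle]
    have h₂ : β₂ ⊓ (α ⊔ β₁) = β₁ := by
      rw [inf_sup_left, inf_eq_right.2 hle, inf_comm, ← hi]; exact sup_eq_right.2 inf_le_right
    simp only [map_sub, map_add, map_neg, map_smul, diamondMap_gen, smul_eq_mul, diamondRel, h₁, h₂,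
      ← hi]
    ring
  · refine HasLinearCoeffs.mem_linearSpan (.add (.sub ?_ ?_) ?_) ?_
    any_goals apply hasLinearCoeffs_X_smul_gen
    have h₁ : β₂ ⊔ (α ⊔ β₁) = α ⊔ β₂ := by
      rw [sup_left_comm, sup_eq_left.2 hle]
    have h₂ : β₂ ⊓ (α ⊔ β₁) = β₁ := by
      rw [inf_sup_left, inf_eq_right.2 hle, inf_comm, ← hi]; exact sup_eq_right.2 inf_le_right
    simp only [map_sub, map_add, map_smul, diamondMap_gen, smul_eq_mul, diamondRel, h₁, h₂, ← hi]
    ring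

theorem lTypes_subset_linearSpan : lTypes K ⊆ (linearSpan K L : Set (DiamondModule K L)) := by
  rintro s ⟨α, β₁, β₂, ⟨-, -, -, -, hle, -, -, -, -⟩, rfl⟩
  refine HasLinearCoeffs.mem_linearSpan (.sub (.add (.add (.neg ?_) ?_) ?_) ?_) ?_
  any_goals apply hasLinearCoeffs_X_smul_gen
  have h₁ : β₂ ⊔ (α ⊔ β₁) = α ⊔ β₂ := by
    rw [sup_left_comm, sup_eq_left.2 hle]
  have h₂ : β₁ ⊓ (α ⊓ β₂) = α ⊓ β₁ := by
    rw [inf_left_comm, inf_eq_left.2 hle]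
  have h₃ : β₂ ⊓ (α ⊔ β₁) = β₁ ⊔ (α ⊓ β₂) := by
    rw [inf_sup_left, inf_eq_right.2 hle, inf_comm, sup_comm]
  simp only [map_sub, map_add, map_neg, map_smul, diamondMap_gen, smul_eq_mul, diamondRel, h₁, h₂,
    h₃]
  ring

/-- The inequalities `α ⊓ β₂ ≤ β₁ ≤ α ⊔ β₂` determine the joins and meets of all auxiliary diamonds.
-/
theorem boxTypes_subset_linearSpan : boxTypes K ⊆ (linearSpan K L : Set (DiamondModule K L)) := by
  rintro s ⟨α, β₁, β₂, ⟨-, -, -, -, -, hs, hi, -, -⟩, h⟩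
  have h₁ : α ⊔ β₁ ⊔ (β₁ ⊔ β₂) = α ⊔ β₂ :=
    le_antisymm (sup_le (sup_le le_sup_left hs) (sup_le hs le_sup_right))
      (sup_le_sup le_sup_left le_sup_right)
  have h₂ : (α ⊔ β₁) ⊓ (β₁ ⊔ β₂) = β₁ := by
    rw [sup_comm α, ← sup_inf_left]; exact sup_eq_left.2 hi
  have h₃ : β₂ ⊔ (α ⊓ β₁) = β₁ ⊔ β₂ := by
    rw [sup_inf_left, sup_comm β₂ β₁, sup_comm β₂ α]
    exact inf_eq_right.2 (sup_le hs le_sup_right)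
  have h₄ : β₂ ⊓ (α ⊓ β₁) = α ⊓ β₂ := by
    rw [← inf_assoc, inf_comm β₂]; exact inf_eq_left.2 hi
  have h₅ : α ⊔ (β₁ ⊓ β₂) = α ⊔ β₁ := by
    rw [sup_inf_left]; exact inf_eq_left.2 (sup_le le_sup_left hs)
  have h₆ : α ⊓ (β₁ ⊓ β₂) = α ⊓ β₂ := by
    rw [inf_left_comm]; exact inf_eq_right.2 hi
  rcases h with rfl | rfl
  · refine HasLinearCoeffs.mem_linearSpan (.sub (.sub (.add (.neg ?_) ?_) ?_) ?_) ?_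
    any_goals apply hasLinearCoeffs_X_smul_gen
    simp only [map_sub, map_add, map_neg, map_smul, diamondMap_gen, smul_eq_mul, diamondRel, h₁,
      h₂, h₃, h₄]
    ring
  · refine HasLinearCoeffs.mem_linearSpan (.add (.add (.add (.neg ?_) ?_) ?_) ?_) ?_
    any_goals apply hasLinearCoeffs_X_smul_gen
    simp only [map_add, map_neg, map_smul, diamondMap_gen, smul_eq_mul, diamondRel, h₁, h₂, h₅, h₆]
    ring

end Distrib

/-! ### Exchange paths on monomials -/

section Rewriting

open Finsupp (single weight)

/-- Iterated, this sorts two exchanges of one monomial by the variables they share. -/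
theorem eq_or_exists_add_of_add_single_eq {n k : L →₀ ℕ} {b d : L}
    (h : n + single b 1 = k + single d 1) :
    (b = d ∧ n = k) ∨ ∃ r, n = r + single d 1 ∧ k = r + single b 1 := by
  classical
  by_cases hbd : b = d
  · subst hbd
    exact .inl ⟨rfl, add_right_cancel h⟩
  · right
    have hd : single d 1 ≤ n := by
      rw [Finsupp.single_le_iff]
      have := DFunLike.congr_fun h d
      simp [hbd] at this
      lia
    obtain ⟨r, rfl⟩ := exists_add_of_le hd
    refine ⟨r, add_comm _ _, ?_⟩
    rw [add_comm (single d 1) r, add_right_comm] at h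
    exact (add_right_cancel h).symm

variable [Lattice L] (N : Submodule (MvPolynomial L K) (DiamondModule K L)) (wt : L → ℕ)

theorem weight_exchange_lt
    (hwt : ∀ a b : L, Incomp a b → wt (a ⊔ b) + wt (a ⊓ b) < wt a + wt b)
    (n : L →₀ ℕ) {a b : L} (h : Incomp a b) :
    weight wt (n + single (a ⊔ b) 1 + single (a ⊓ b) 1) <
      weight wt (n + single a 1 + single b 1) := by
  have := hwt a b h
  simp only [map_add, Finsupp.weight_single, smul_eq_mul, one_mul]
  lia

open Classical in
/-- The class modulo `N` of a sequence of exchanges `x_a x_b → x_{a ⊔ b} x_{a ⊓ b}` that brings a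
monomial into its normal form. -/
def pathClass
    (hwt : ∀ a b : L, Incomp a b → wt (a ⊔ b) + wt (a ⊓ b) < wt a + wt b)
    (m : L →₀ ℕ) : DiamondModule K L ⧸ N :=
  if h : ∃ p : (L →₀ ℕ) × L × L, Incomp p.2.1 p.2.2 ∧
      m = p.1 + single p.2.1 1 + single p.2.2 1 then
    N.mkQ (monomial h.choose.1 (1 : K) • gen K h.choose.2.1 h.choose.2.2) +
      pathClass hwt (h.choose.1 + single (h.choose.2.1 ⊔ h.choose.2.2) 1
        + single (h.choose.2.1 ⊓ h.choose.2.2) 1)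
  else 0
termination_by weight wt m
decreasing_by
  conv_rhs => rw [h.choose_spec.2]
  exact weight_exchange_lt wt hwt _ h.choose_spec.1

/-- The class modulo `N` of a path to the normal form that starts with the exchange of `a`, `b`. -/
def stepClass
    (hwt : ∀ a b : L, Incomp a b → wt (a ⊔ b) + wt (a ⊓ b) < wt a + wt b)
    (n : L →₀ ℕ) (a b : L) : DiamondModule K L ⧸ N :=
  N.mkQ (monomial n (1 : K) • gen K a b) +
    pathClass K N wt hwt (n + single (a ⊔ b) 1 + single (a ⊓ b) 1)

theorem stepClass_comm
    (hwt : ∀ a b : L, Incomp a b → wt (a ⊔ b) + wt (a ⊓ b) < wt a + wt b)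
    (n : L →₀ ℕ) (a b : L) :
    stepClass K N wt hwt n a b = stepClass K N wt hwt n b a := by
  rw [stepClass, stepClass, gen_comm K a b, sup_comm, inf_comm]

/-- On a comparable pair the exchange is the identity and its generator is zero, so `StepInvariant`
may range over all pairs. -/
theorem stepClass_of_not_incomp
    (hwt : ∀ a b : L, Incomp a b → wt (a ⊔ b) + wt (a ⊓ b) < wt a + wt b)
    (n : L →₀ ℕ) {a b : L} (h : ¬ Incomp a b) :
    stepClass K N wt hwt n a b = pathClass K N wt hwt (n + single a 1 + single b 1) := by
  rw [stepClass, gen_of_not_incomp K h, smul_zero, map_zero, zero_add]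
  rcases le_or_ge_of_not_incomp h with h | h
  · rw [sup_eq_right.2 h, inf_eq_left.2 h, add_right_comm]
  · rw [sup_eq_left.2 h, inf_eq_right.2 h]

theorem exists_stepClass_eq_pathClass
    (hwt : ∀ a b : L, Incomp a b → wt (a ⊔ b) + wt (a ⊓ b) < wt a + wt b)
    (n : L →₀ ℕ) {a b : L} (h : Incomp a b) :
    ∃ k c d, Incomp c d ∧ n + single a 1 + single b 1 = k + single c 1 + single d 1 ∧
      pathClass K N wt hwt (n + single a 1 + single b 1) = stepClass K N wt hwt k c d := by
  have hex : ∃ p : (L →₀ ℕ) × L × L, Incomp p.2.1 p.2.2 ∧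
      n + single a 1 + single b 1 = p.1 + single p.2.1 1 + single p.2.2 1 := ⟨(n, a, b), h, rfl⟩
  refine ⟨hex.choose.1, hex.choose.2.1, hex.choose.2.2, hex.choose_spec.1, hex.choose_spec.2, ?_⟩
  rw [pathClass, dif_pos hex, stepClass]

theorem mkQ_monomial_smul (r : L →₀ ℕ) (c : L) (s : DiamondModule K L) :
    N.mkQ (monomial (r + single c 1) (1 : K) • s) =
      N.mkQ (monomial r (1 : K) • (X c : MvPolynomial L K) • s) := by
  rw [smul_smul, X, monomial_mul, one_mul]

/-- The exchange step does not change the class of paths, for monomials of small weight. -/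
def StepInvariant
    (hwt : ∀ a b : L, Incomp a b → wt (a ⊔ b) + wt (a ⊓ b) < wt a + wt b)
    (w : ℕ) : Prop :=
  ∀ (n : L →₀ ℕ) (a b : L), weight wt (n + single a 1 + single b 1) < w →
    pathClass K N wt hwt (n + single a 1 + single b 1) = stepClass K N wt hwt n a b

end Rewriting

/-! ### Confluence modulo a submodule -/

section Confluence

open Finsupp (single weight)

variable [DistribLattice L] (N : Submodule (MvPolynomial L K) (DiamondModule K L)) (wt : L → ℕ)

theorem weight_exchange_le
    (hwt : ∀ a b : L, Incomp a b → wt (a ⊔ b) + wt (a ⊓ b) < wt a + wt b)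
    (n : L →₀ ℕ) (a b : L) :
    weight wt (n + single (a ⊔ b) 1 + single (a ⊓ b) 1) ≤
      weight wt (n + single a 1 + single b 1) := by
  by_cases h : Incomp a b
  · exact (weight_exchange_lt wt hwt n h).le
  · rcases le_or_ge_of_not_incomp h with h | h
    · rw [sup_eq_right.2 h, inf_eq_left.2 h, add_right_comm]
    · rw [sup_eq_left.2 h, inf_eq_right.2 h]

/-- The first exchange lowers the weight strictly, so the induction hypothesis can steer the rest of
the path through the other two exchanges of `sortPath`, which may be trivial. -/
theorem stepClass_eq_sortPath
    (hwt : ∀ a b : L, Incomp a b → wt (a ⊔ b) + wt (a ⊓ b) < wt a + wt b)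
    (r : L →₀ ℕ) {a b c : L} (hab : Incomp a b)
    (ih : StepInvariant K N wt hwt
      (weight wt (r + single c 1 + single a 1 + single b 1))) :
    stepClass K N wt hwt (r + single c 1) a b =
      N.mkQ (monomial r (1 : K) • sortPath K a b c) +
        pathClass K N wt hwt (r + single (a ⊔ b ⊔ c) 1 + single ((a ⊓ b) ⊔ ((a ⊔ b) ⊓ c)) 1
          + single ((a ⊓ b) ⊓ ((a ⊔ b) ⊓ c)) 1) := by
  have e₁ : r + single c 1 + single (a ⊔ b) 1 + single (a ⊓ b) 1 =
      r + single (a ⊓ b) 1 + single (a ⊔ b) 1 + single c 1 := by abel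
  have e₂ : r + single (a ⊓ b) 1 + single (a ⊔ b ⊔ c) 1 + single ((a ⊔ b) ⊓ c) 1 =
      r + single (a ⊔ b ⊔ c) 1 + single (a ⊓ b) 1 + single ((a ⊔ b) ⊓ c) 1 := by abel
  have h₁ := weight_exchange_lt wt hwt (r + single c 1) hab
  rw [e₁] at h₁
  have h₂ := (weight_exchange_le wt hwt (r + single (a ⊓ b) 1) (a ⊔ b) c).trans_lt h₁
  rw [e₂] at h₂
  rw [stepClass, e₁, ih _ _ _ h₁, stepClass, e₂, ih _ _ _ h₂, stepClass, mkQ_monomial_smul,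
    mkQ_monomial_smul, mkQ_monomial_smul, sortPath, smul_add, smul_add, map_add, map_add]
  abel

theorem stepClass_eq_of_overlap
    (hwt : ∀ a b : L, Incomp a b → wt (a ⊔ b) + wt (a ⊓ b) < wt a + wt b)
    (hlin : linearSpan K L ≤ N)
    (r : L →₀ ℕ) {a b c : L} (hab : Incomp a b) (hac : Incomp a c)
    (ih : StepInvariant K N wt hwt
      (weight wt (r + single c 1 + single a 1 + single b 1))) :
    stepClass K N wt hwt (r + single c 1) a b = stepClass K N wt hwt (r + single b 1) a c := by
  rw [stepClass_eq_sortPath K N wt hwt r hab ih, stepClass_eq_sortPath K N wt hwt r hac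
    (by rwa [show r + single b 1 + single a 1 + single c 1 =
      r + single c 1 + single a 1 + single b 1 by abel])]
  have h := N.smul_mem (monomial r (1 : K)) (hlin (sortPath_sub_mem K a b c))
  rw [smul_sub, ← Submodule.Quotient.mk_eq_zero, Submodule.Quotient.mk_sub, sub_eq_zero] at h
  rw [Submodule.mkQ_apply, Submodule.mkQ_apply, h, median_swap a b c, inf_inf_sup_inf,
    inf_inf_sup_inf, inf_right_comm, sup_right_comm]

/-- The exchanges commute, and the two orders differ by `x^r` times the diamond-type syzygy. -/
theorem stepClass_eq_of_diamondSyzygy_mem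
    (hwt : ∀ a b : L, Incomp a b → wt (a ⊔ b) + wt (a ⊓ b) < wt a + wt b)
    (r : L →₀ ℕ) {a b c d : L} (hab : Incomp a b)
    (hcd : Incomp c d) (h : diamondSyzygy K a b c d ∈ N)
    (ih : StepInvariant K N wt hwt
      (weight wt (r + single c 1 + single d 1 + single a 1 + single b 1))) :
    stepClass K N wt hwt (r + single c 1 + single d 1) a b =
      stepClass K N wt hwt (r + single a 1 + single b 1) c d := by
  have e₁ : r + single c 1 + single d 1 + single (a ⊔ b) 1 + single (a ⊓ b) 1 =
      r + single (a ⊔ b) 1 + single (a ⊓ b) 1 + single c 1 + single d 1 := by abel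
  have e₂ : r + single a 1 + single b 1 + single (c ⊔ d) 1 + single (c ⊓ d) 1 =
      r + single (c ⊔ d) 1 + single (c ⊓ d) 1 + single a 1 + single b 1 := by abel
  have e₃ : r + single a 1 + single b 1 + single c 1 + single d 1 =
      r + single c 1 + single d 1 + single a 1 + single b 1 := by abel
  have e₄ : r + single (c ⊔ d) 1 + single (c ⊓ d) 1 + single (a ⊔ b) 1 + single (a ⊓ b) 1 =
      r + single (a ⊔ b) 1 + single (a ⊓ b) 1 + single (c ⊔ d) 1 + single (c ⊓ d) 1 := by abel
  have h₁ := weight_exchange_lt wt hwt (r + single c 1 + single d 1) hab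
  have h₂ := weight_exchange_lt wt hwt (r + single a 1 + single b 1) hcd
  rw [e₁] at h₁
  rw [e₂, e₃] at h₂
  rw [stepClass, e₁, ih _ _ _ h₁, stepClass, stepClass, e₂, ih _ _ _ h₂, stepClass, e₄,
    ← add_assoc, ← add_assoc]
  congr 1
  rw [← map_add, ← map_add, ← sub_eq_zero, ← map_sub, Submodule.mkQ_apply,
    Submodule.Quotient.mk_eq_zero]
  convert N.smul_mem (monomial r (1 : K)) h using 1
  have e (p q : L) : monomial (r + single p 1 + single q 1) (1 : K) =
      monomial r 1 * (X p * X q) := by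
    rw [X, X, monomial_mul, monomial_mul, one_mul, one_mul, add_assoc]
  simp only [e, diamondSyzygy, diamondRel]
  module

/-- In a mixed pattern of inequalities some element lies between the two of the other pair, making
that pair comparable. -/
theorem comparable_of_no_cross_incomp {a b c d : L} (hab : Incomp a b) (hcd : Incomp c d)
    (h₁ : ¬ Incomp a c) (h₂ : ¬ Incomp a d) (h₃ : ¬ Incomp b c) (h₄ : ¬ Incomp b d) :
    DiamondsComparable a b c d ∨ DiamondsComparable c d a b := by
  have hab' := hab.1
  have hab'' := hab.2
  have hcd' := hcd.1
  have hcd'' := hcd.2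
  unfold DiamondsComparable
  rcases le_or_ge_of_not_incomp h₁ with h₁ | h₁ <;> rcases le_or_ge_of_not_incomp h₂ with h₂ | h₂ <;>
    rcases le_or_ge_of_not_incomp h₃ with h₃ | h₃ <;>
    rcases le_or_ge_of_not_incomp h₄ with h₄ | h₄ <;>
    first
      | exact .inl ⟨h₁, h₂, h₃, h₄⟩
      | exact .inr ⟨h₁, h₃, h₂, h₄⟩
      | exact (hcd' (h₁.trans h₂)).elim
      | exact (hcd'' (h₂.trans h₁)).elim
      | exact (hcd' (h₃.trans h₄)).elim
      | exact (hcd'' (h₄.trans h₃)).elim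
      | exact (hab' (h₁.trans h₃)).elim
      | exact (hab'' (h₃.trans h₁)).elim

theorem stepClass_eq_of_disjoint
    (hwt : ∀ a b : L, Incomp a b → wt (a ⊔ b) + wt (a ⊓ b) < wt a + wt b)
    (hlin : linearSpan K L ≤ N)
    (hcomp : ∀ a b c d : L, Incomp a b → Incomp c d → DiamondsComparable a b c d →
      diamondSyzygy K a b c d ∈ N)
    (r : L →₀ ℕ) {a b c d : L} (hab : Incomp a b)
    (hcd : Incomp c d)
    (ih : StepInvariant K N wt hwt
      (weight wt (r + single c 1 + single d 1 + single a 1 + single b 1))) :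
    stepClass K N wt hwt (r + single c 1 + single d 1) a b =
      stepClass K N wt hwt (r + single a 1 + single b 1) c d := by
  -- The exchange of `a`, `c` shares a variable with each of the two given ones, so two overlaps
  -- suffice.
  have cross : ∀ {a b c d : L}, Incomp a b → Incomp c d → Incomp a c →
      StepInvariant K N wt hwt
        (weight wt (r + single c 1 + single d 1 + single a 1 + single b 1)) →
      stepClass K N wt hwt (r + single c 1 + single d 1) a b =
        stepClass K N wt hwt (r + single a 1 + single b 1) c d := by
    intro a b c d hab hcd hac ih
    rw [show r + single c 1 + single d 1 = r + single d 1 + single c 1 by abel,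
      stepClass_eq_of_overlap K N wt hwt hlin (r + single d 1) hab hac
        (by rwa [show r + single d 1 + single c 1 = r + single c 1 + single d 1 by abel]),
      stepClass_comm, show r + single d 1 + single b 1 = r + single b 1 + single d 1 by abel,
      stepClass_eq_of_overlap K N wt hwt hlin (r + single b 1) hac.symm hcd
        (by rwa [show r + single b 1 + single d 1 + single c 1 + single a 1 =
          r + single c 1 + single d 1 + single a 1 + single b 1 by abel]),
      show r + single b 1 + single a 1 = r + single a 1 + single b 1 by abel]
  by_cases h₁ : Incomp a c
  · exact cross hab hcd h₁ ih
  have sab : ∀ s : L →₀ ℕ, s + single b 1 + single a 1 = s + single a 1 + single b 1 :=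
    fun s => add_right_comm _ _ _
  have scd : r + single d 1 + single c 1 = r + single c 1 + single d 1 := add_right_comm _ _ _
  by_cases h₂ : Incomp a d
  · have := cross hab hcd.symm h₂ (by rwa [scd])
    rwa [scd, stepClass_comm K N wt hwt _ d] at this
  by_cases h₃ : Incomp b c
  · have := cross hab.symm hcd h₃ (by rwa [sab])
    rwa [sab, stepClass_comm K N wt hwt _ b] at this
  by_cases h₄ : Incomp b d
  · have := cross hab.symm hcd.symm h₄ (by rwa [sab, scd])
    rwa [sab, scd, stepClass_comm K N wt hwt _ b, stepClass_comm K N wt hwt _ d] at this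
  refine stepClass_eq_of_diamondSyzygy_mem K N wt hwt r hab hcd ?_ ih
  rcases comparable_of_no_cross_incomp hab hcd h₁ h₂ h₃ h₄ with h | h
  · exact hcomp _ _ _ _ hab hcd h
  · rw [diamondSyzygy_swap]
    exact N.neg_mem (hcomp _ _ _ _ hcd hab h)

theorem stepClass_eq_stepClass
    (hwt : ∀ a b : L, Incomp a b → wt (a ⊔ b) + wt (a ⊓ b) < wt a + wt b)
    (hlin : linearSpan K L ≤ N)
    (hcomp : ∀ a b c d : L, Incomp a b → Incomp c d → DiamondsComparable a b c d →
      diamondSyzygy K a b c d ∈ N)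
    {n k : L →₀ ℕ} {a b c d : L} (hab : Incomp a b) (hcd : Incomp c d)
    (h : n + single a 1 + single b 1 = k + single c 1 + single d 1)
    (ih : StepInvariant K N wt hwt (weight wt (n + single a 1 + single b 1))) :
    stepClass K N wt hwt n a b = stepClass K N wt hwt k c d := by
  rcases eq_or_exists_add_of_add_single_eq h with ⟨rfl, h'⟩ | ⟨s, h₁, h₂⟩
  · rcases eq_or_exists_add_of_add_single_eq h' with ⟨rfl, rfl⟩ | ⟨r, rfl, rfl⟩
    · rfl
    · rw [stepClass_comm K N wt hwt _ a, stepClass_comm K N wt hwt _ c]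
      exact stepClass_eq_of_overlap K N wt hwt hlin r hab.symm hcd.symm
        (by rwa [add_right_comm (r + single c 1)])
  · rcases eq_or_exists_add_of_add_single_eq h₁ with ⟨rfl, rfl⟩ | ⟨t, rfl, rfl⟩
    · rcases eq_or_exists_add_of_add_single_eq h₂ with ⟨rfl, rfl⟩ | ⟨r, rfl, rfl⟩
      · exact stepClass_comm ..
      · rw [stepClass_comm K N wt hwt _ c]
        exact stepClass_eq_of_overlap K N wt hwt hlin r hab hcd.symm ih
    · rcases eq_or_exists_add_of_add_single_eq h₂ with ⟨rfl, rfl⟩ | ⟨r, rfl, h'⟩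
      · rw [stepClass_comm K N wt hwt _ a]
        exact stepClass_eq_of_overlap K N wt hwt hlin t hab.symm hcd
          (by rwa [add_right_comm (t + single d 1)])
      · rcases eq_or_exists_add_of_add_single_eq h' with ⟨rfl, rfl⟩ | ⟨q, rfl, rfl⟩
        · exact stepClass_eq_of_overlap K N wt hwt hlin t hab hcd ih
        · exact stepClass_eq_of_disjoint K N wt hwt hlin hcomp q hab hcd ih

theorem pathClass_eq_stepClass
    (hwt : ∀ a b : L, Incomp a b → wt (a ⊔ b) + wt (a ⊓ b) < wt a + wt b)
    (hlin : linearSpan K L ≤ N)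
    (hcomp : ∀ a b c d : L, Incomp a b → Incomp c d → DiamondsComparable a b c d →
      diamondSyzygy K a b c d ∈ N)
    (n : L →₀ ℕ) (a b : L) :
    pathClass K N wt hwt (n + single a 1 + single b 1) = stepClass K N wt hwt n a b := by
  suffices h : ∀ w, StepInvariant K N wt hwt w from h _ n a b (Nat.lt_succ_self _)
  intro w
  induction w with
  | zero => exact fun _ _ _ h => absurd h (Nat.not_lt_zero _)
  | succ w ih =>
    intro n a b h
    by_cases hab : Incomp a b
    -- The chosen path itself begins with some exchange, so only two first steps need comparing.
    · obtain ⟨k, c, d, hcd, he, hp⟩ := exists_stepClass_eq_pathClass K N wt hwt n hab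
      rw [hp]
      refine (stepClass_eq_stepClass K N wt hwt hlin hcomp hab hcd he fun n' a' b' h' => ?_).symm
      exact ih n' a' b' (h'.trans_le (Nat.lt_succ_iff.1 h))
    · exact (stepClass_of_not_incomp K N wt hwt n hab).symm

/-- If exchanges of incomparable pairs decrease some weight, then the first syzygy is generated by
the linear syzygies and the diamond-type syzygies of the comparable pairs of diamonds. -/
theorem firstSyzygy_le_of_diamondSyzygy_mem
    (hwt : ∀ a b : L, Incomp a b → wt (a ⊔ b) + wt (a ⊓ b) < wt a + wt b)
    (hlin : linearSpan K L ≤ N)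
    (hcomp : ∀ a b c d : L, Incomp a b → Incomp c d → DiamondsComparable a b c d →
      diamondSyzygy K a b c d ∈ N) :
    firstSyzygy K L ≤ N := by
  -- Only `K`-linear, so `ψ ∘ φ = N.mkQ` is checked on monomial multiples of generators.
  let ψ : MvPolynomial L K →ₗ[K] DiamondModule K L ⧸ N :=
    (basisMonomials L K).constr K (pathClass K N wt hwt)
  have hψ : ∀ m, ψ (monomial m 1) = pathClass K N wt hwt m := fun m => by
    simpa using (basisMonomials L K).constr_basis K (pathClass K N wt hwt) m
  have hgen : ∀ (n : L →₀ ℕ) (a b : L),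
      ψ (diamondMap K L (monomial n (1 : K) • gen K a b)) =
        N.mkQ (monomial n (1 : K) • gen K a b) := by
    intro n a b
    have e (p q : L) : monomial n (1 : K) * (X p * X q) =
        monomial (n + single p 1 + single q 1) 1 := by
      rw [X, X, monomial_mul, monomial_mul, one_mul, one_mul, add_assoc]
    rw [map_smul, diamondMap_gen, diamondRel, smul_eq_mul, mul_sub, e, e, map_sub, hψ, hψ,
      pathClass_eq_stepClass K N wt hwt hlin hcomp, stepClass, add_sub_cancel_right]
  have key : ∀ s : DiamondModule K L, ψ (diamondMap K L s) = N.mkQ s := by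
    intro s
    induction s using Finsupp.induction_linear with
    | zero => simp only [map_zero]
    | add s t hs ht => simp only [map_add, hs, ht]
    | single d p =>
      obtain ⟨z, hz⟩ := d
      induction z using Sym2.ind with
      | _ a b =>
        have hab : Incomp a b := hz
        have hg : ∀ p : MvPolynomial L K, Finsupp.single ⟨s(a, b), hz⟩ p = p • gen K a b :=
          fun p => by rw [gen, dif_pos hab, Finsupp.smul_single, smul_eq_mul, mul_one]
        rw [hg]
        induction p using MvPolynomial.induction_on' with
        | monomial n c =>
          rw [show monomial n c = c • monomial n (1 : K) by rw [smul_monomial, smul_eq_mul, mul_one],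
            smul_assoc, LinearMap.map_smul_of_tower (diamondMap K L), LinearMap.map_smul ψ, hgen]
          exact (LinearMap.map_smul_of_tower N.mkQ c _).symm
        | add p q hp hq => simp only [add_smul, map_add, hp, hq]
  intro s hs
  rw [← Submodule.Quotient.mk_eq_zero, ← Submodule.mkQ_apply, ← key, LinearMap.mem_ker.1 hs,
    map_zero]

end Confluence

/-! ### Termination of exchanges -/

/-- On a finite planar lattice there is a weight that every exchange of an incomparable pair
decreases. -/
theorem IsPlanarLattice.exists_weight {L : Type*} [Lattice L] [Finite L]
    (h : IsPlanarLattice L) :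
    ∃ wt : L → ℕ, ∀ a b : L, Incomp a b → wt (a ⊔ b) + wt (a ⊓ b) < wt a + wt b := by
  obtain ⟨f, hf⟩ := h
  have hle : ∀ a b : L, f a ≤ f b → a ≤ b := fun a b h =>
    inf_eq_left.1 (hf (by rw [map_inf]; exact inf_eq_left.2 h))
  obtain ⟨M, hM⟩ : ∃ M, ∀ a : L, (f a).1 + (f a).2 ≤ M := by
    obtain ⟨M, hM⟩ := (Set.finite_range fun a : L => (f a).1 + (f a).2).bddAbove
    exact ⟨M, fun a => hM ⟨a, rfl⟩⟩
  -- With `ρ` the coordinate sum, the weight is `ρ (M - ρ)`; the bound `M` prevents truncation. An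
  -- exchange preserves the sum of the two values of `ρ` but spreads them, lowering the weight by
  -- twice the product of the coordinate gaps.
  refine ⟨fun a => ((f a).1 + (f a).2) * (M - ((f a).1 + (f a).2)), fun a b hab => ?_⟩
  have h₁ := hM (a ⊔ b)
  have h₂ := hM (a ⊓ b)
  have h₃ := hM a
  have h₄ := hM b
  have hab₁ : ¬ f a ≤ f b := fun h => hab.1 (hle _ _ h)
  have hab₂ : ¬ f b ≤ f a := fun h => hab.2 (hle _ _ h)
  rw [map_sup, Prod.fst_sup, Prod.snd_sup] at h₁
  rw [map_inf, Prod.fst_inf, Prod.snd_inf] at h₂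
  simp only [map_sup, map_inf, Prod.fst_sup, Prod.snd_sup, Prod.fst_inf, Prod.snd_inf]
  rw [Prod.le_def, not_and_or, not_le, not_le] at hab₁ hab₂
  rcases hab₁ with h | h <;> rcases hab₂ with h' | h'
  · omega
  · rw [max_eq_left h.le, max_eq_right h'.le] at h₁ ⊢
    rw [min_eq_right h.le, min_eq_left h'.le] at h₂ ⊢
    zify [h₁, h₂, h₃, h₄] at h h' ⊢
    nlinarith [mul_pos (sub_pos.2 h) (sub_pos.2 h')]
  · rw [max_eq_right h'.le, max_eq_left h.le] at h₁ ⊢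
    rw [min_eq_left h'.le, min_eq_right h.le] at h₂ ⊢
    zify [h₁, h₂, h₃, h₄] at h h' ⊢
    nlinarith [mul_pos (sub_pos.2 h) (sub_pos.2 h')]
  · omega

end Linear

end

theorem mainTheorem3 (K : Type*) [Field K] (L : Type*) [DistribLattice L] [Finite L]
    (hplanar : IsPlanarLattice L)
    (hdiamond : ∀ α₁ β₁ α₂ β₂ : L, Incomp α₁ β₁ → Incomp α₂ β₂ →
      ¬ DiamondsComparable α₁ β₁ α₂ β₂ ∨ HasJoiningDiamond α₁ β₁ α₂ β₂ ∨
        DiamondExpressible K α₁ β₁ α₂ β₂) :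
    FirstSyzygyIsLinear K L := by
  refine le_antisymm (Submodule.span_le.2 fun s hs => hs.1) ?_
  obtain ⟨wt, hwt⟩ := hplanar.exists_weight
  -- With `N` the linear span itself, only comparable pairs of diamonds remain.
  refine firstSyzygy_le_of_diamondSyzygy_mem K (linearSpan K L) wt hwt le_rfl ?_
  intro a b c d hab hcd hcomp
  rcases hdiamond a b c d hab hcd with h | h | h
  · exact absurd hcomp h
  · exact diamondSyzygy_mem_of_hasJoiningDiamond K h
  · exact Submodule.span_le.2 (Set.union_subset (Set.union_subset (stripTypes_subset_linearSpan K)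
      (lTypes_subset_linearSpan K)) (boxTypes_subset_linearSpan K)) h
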